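/- Let $$P(x_1,\dots,x_5)=x_1x_4+x_2x_5+x_2x_3x_4-x_1x_2x_3x_4-x_1x_2x_4x_5-x_2x_3x_4x_5+x_1x_2x_3x_4x_5$$ be the reliability polynomial of the bridge network, and let $\mathcal H=\{x\in\mathbb R^6 : x_6=P(x_1,\dots,x_5)\}$ be its graph, the reliability hypersurface. Then the family $\mathcal F$ of all straight lines contained in $\mathcal H$ (each line regarded as a set of points) depends on at least five and at most six parameters, in the following sense. A smooth $k$-parameter family of lines consists of an open set $U\subseteq\mathbb R^k$ and $C^\infty$ maps $a,b:U\to\mathbb R^6$ with $a(u)\neq 0$ for all $u\in U$; its members are the lines $\ell_u=\{t\,a(u)+b(u): t\in\mathbb R\}$. Its parameters are called essential if $u\mapsto \ell_u$ is injective and is an immersion into the manifold of lines, i.e. if for $u\in U$ and $w\in\mathbb R^k$ the conditions $Da(u)w\in\mathbb R\,a(u)$ and $Db(u)w\in\mathbb R\,a(u)$ imply $w=0$. 1. (At least five.) There is a smooth family of lines with five essential parameters and nonempty $U\subseteq\mathbb R^5$, all of whose members belong to $\mathcal F$. 2. (At most six.) $\mathcal F$ is the union of finitely many smooth $6$-parameter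 families of lines (whose parameters need not be essential). -/

import Mathlib

open scoped ContDiff

noncomputable section

/-- The reliability polynomial of the bridge network. The variable `X i` (`i = 0, …, 4`) is the
reliability `R_{i+1}` of the `(i+1)`-st component. -/
def bridgePolynomial : MvPolynomial (Fin 5) ℝ :=
  .X 0 * .X 3 + .X 1 * .X 4 + .X 1 * .X 2 * .X 3
    - .X 0 * .X 1 * .X 2 * .X 3 - .X 0 * .X 1 * .X 3 * .X 4 - .X 1 * .X 2 * .X 3 * .X 4
    + .X 0 * .X 1 * .X 2 * .X 3 * .X 4

/-- The reliability hypersurface: the graph of the reliability polynomial in `ℝ⁶`. The last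
coordinate is the value of the polynomial. -/
def reliabilityHypersurface : Set (Fin 6 → ℝ) :=
  {x | x 5 = MvPolynomial.eval (fun i : Fin 5 => x i.castSucc) bridgePolynomial}

/-- The set of all points `t a + b`, `t ∈ ℝ` (a straight line if `a ≠ 0`). -/
def lineSet {n : ℕ} (a b : Fin n → ℝ) : Set (Fin n → ℝ) :=
  Set.range fun t : ℝ => t • a + b

/-- The straight lines contained in `S`, each line being regarded as a set of points. -/
def linesIn {n : ℕ} (S : Set (Fin n → ℝ)) : Set (Set (Fin n → ℝ)) :=
  {L | (∃ a b : Fin n → ℝ, a ≠ 0 ∧ L = lineSet a b) ∧ L ⊆ S}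

/-- A smooth `k`-parameter family of straight lines `t ↦ t a(u) + b(u)`, with `u` running through
an open set `U` of `ℝᵏ`. -/
structure IsSmoothLineFamily {k n : ℕ} (U : Set (Fin k → ℝ))
    (a b : (Fin k → ℝ) → (Fin n → ℝ)) : Prop where
  isOpen : IsOpen U
  smooth_direction : ContDiffOn ℝ ∞ a U
  smooth_point : ContDiffOn ℝ ∞ b U
  direction_ne_zero : ∀ u ∈ U, a u ≠ 0

/-- All `k` parameters of the family are essential: different parameters give different lines, and
the map from parameters to lines has Jacobian rank `k` everywhere. Since `(a, b)` and
`(α a, b + β a)`, `α ≠ 0`, describe the same line, an infinitesimal change `(a', b')` of `(a, b)`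
leaves the line fixed to first order exactly if `a'` and `b'` are multiples of `a`. -/
structure HasEssentialParameters {k n : ℕ} (U : Set (Fin k → ℝ))
    (a b : (Fin k → ℝ) → (Fin n → ℝ)) : Prop where
  injOn : Set.InjOn (fun u => lineSet (a u) (b u)) U
  full_rank : ∀ u ∈ U, ∀ w : Fin k → ℝ,
    fderiv ℝ a u w ∈ Submodule.span ℝ {a u} →
    fderiv ℝ b u w ∈ Submodule.span ℝ {a u} → w = 0

/-- The family `F` of straight lines depends on at least `k` parameters: it contains a nonempty
smooth family with `k` essential parameters. -/
def DependsOnAtLeast {n : ℕ} (F : Set (Set (Fin n → ℝ))) (k : ℕ) : Prop :=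
  ∃ (U : Set (Fin k → ℝ)) (a b : (Fin k → ℝ) → (Fin n → ℝ)),
    U.Nonempty ∧ IsSmoothLineFamily U a b ∧ HasEssentialParameters U a b ∧
      ∀ u ∈ U, lineSet (a u) (b u) ∈ F

/-- The family `F` of straight lines depends on at most `k` parameters: it is the union of finitely
many smooth families with `k` parameters (which need not be essential). -/
def DependsOnAtMost {n : ℕ} (F : Set (Set (Fin n → ℝ))) (k : ℕ) : Prop :=
  ∃ (m : ℕ) (U : Fin m → Set (Fin k → ℝ)) (a b : Fin m → (Fin k → ℝ) → (Fin n → ℝ)),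
    (∀ j, IsSmoothLineFamily (U j) (a j) (b j)) ∧
      F = ⋃ j, (fun u => lineSet (a j u) (b j u)) '' U j

end

/-!
A line lies in the graph of `f` exactly when it is the lift of a line along which `f` is affine. The
reliability is affine in each variable, hence a polynomial of degree at most five along any line,
and it is affine there only if its coefficients of degree at least two vanish. This forces one of
two cases. Either only the bridge coordinate is constant; it then equals `1`, and the remaining
conditions have a closed-form solution with six free parameters. Or two coordinates are constant;
taking a third coordinate as the parameter of the line leaves six numbers subject to equations that
are affine in suitable unknowns. Solving these for an unknown, and treating the locus where its
coefficient vanishes separately, yields finitely many smooth maps from open subsets of `ℝ⁶`.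

Five essential parameters occur on the hyperplane `x₁ = 0`, where the reliability is `x₀ x₃` and any
line with `x₃` constant lifts to the graph.
-/

section Smoothness

variable {E : Type*} [NormedAddCommGroup E] [NormedSpace ℝ E] {r : ℕ∞ω} {m : ℕ}

@[fun_prop]
theorem contDiff_vecCons {g : E → ℝ} {h : E → Fin m → ℝ} (hg : ContDiff ℝ r g)
    (hh : ContDiff ℝ r h) : ContDiff ℝ r fun x => Matrix.vecCons (g x) (h x) :=
  contDiff_pi.2 (Fin.cases hg (contDiff_pi.1 hh))

@[fun_prop]
theorem contDiff_snoc {g : E → ℝ} {h : E → Fin m → ℝ} (hg : ContDiff ℝ r g)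
    (hh : ContDiff ℝ r h) : ContDiff ℝ r fun x => (Fin.snoc (h x) (g x) : Fin (m + 1) → ℝ) :=
  contDiff_pi.2 (Fin.lastCases (by simpa using hg) (by simpa using contDiff_pi.1 hh))

theorem contDiffOn_update {ι : Type*} [Fintype ι] [DecidableEq ι] (i : ι) {h : E → ι → ℝ}
    {g : E → ℝ} {s : Set E} (hh : ContDiffOn ℝ r h s) (hg : ContDiffOn ℝ r g s) :
    ContDiffOn ℝ r (fun x => Function.update (h x) i (g x)) s := by
  refine contDiffOn_pi.2 fun j => ?_
  rcases eq_or_ne j i with rfl | hj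
  · simpa only [Function.update_self] using hg
  · simpa only [Function.update_of_ne hj] using contDiffOn_pi.1 hh j

end Smoothness

/-- `S` is a finite union of images of open subsets of the parameter space `E` under smooth maps. -/
inductive SmoothlyParametrized (E : Type*) [NormedAddCommGroup E] [NormedSpace ℝ E]
    {X : Type*} [NormedAddCommGroup X] [NormedSpace ℝ X] : Set X → Prop
  | empty : SmoothlyParametrized E ∅
  | image {U : Set E} {f : E → X} (hU : IsOpen U) (hf : ContDiffOn ℝ ∞ f U) :
      SmoothlyParametrized E (f '' U)
  | union {S T : Set X} (hS : SmoothlyParametrized E S) (hT : SmoothlyParametrized E T) :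
      SmoothlyParametrized E (S ∪ T)

namespace SmoothlyParametrized

section Basic

variable {E : Type*} [NormedAddCommGroup E] [NormedSpace ℝ E]
  {X : Type*} [NormedAddCommGroup X] [NormedSpace ℝ X]
  {Y : Type*} [NormedAddCommGroup Y] [NormedSpace ℝ Y]

theorem univ : SmoothlyParametrized E (Set.univ : Set E) := by
  simpa using SmoothlyParametrized.image (E := E) (f := id) isOpen_univ contDiffOn_id

theorem biUnion {ι : Type*} {s : Set ι} (hs : s.Finite) {T : ι → Set X}
    (hT : ∀ i ∈ s, SmoothlyParametrized E (T i)) : SmoothlyParametrized E (⋃ i ∈ s, T i) := by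
  induction s, hs using Set.Finite.induction_on with
  | empty => simpa using SmoothlyParametrized.empty
  | insert _ _ ih =>
    rw [Set.biUnion_insert]
    exact (hT _ (Set.mem_insert _ _)).union (ih fun i hi => hT i (Set.mem_insert_of_mem _ hi))

theorem iUnion {ι : Type*} [Finite ι] {T : ι → Set X} (hT : ∀ i, SmoothlyParametrized E (T i)) :
    SmoothlyParametrized E (⋃ i, T i) := by
  simpa using biUnion Set.finite_univ fun i _ => hT i

theorem image_inter {S : Set X} (hS : SmoothlyParametrized E S) {W : Set X} (hW : IsOpen W)
    {g : X → Y} (hg : ContDiffOn ℝ ∞ g W) : SmoothlyParametrized E (g '' (S ∩ W)) := by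
  induction hS with
  | empty => simpa using SmoothlyParametrized.empty
  | @image U f hU hf =>
    rw [← Set.image_inter_preimage, ← Set.image_comp]
    exact .image (hf.continuousOn.isOpen_inter_preimage hU hW)
      (hg.comp (hf.mono Set.inter_subset_left) fun _ hx => hx.2)
  | union _ _ ihS ihT =>
    rw [Set.union_inter_distrib_right, Set.image_union]
    exact ihS.union ihT

theorem image_of_contDiff {S : Set X} (hS : SmoothlyParametrized E S) {g : X → Y}
    (hg : ContDiff ℝ ∞ g) : SmoothlyParametrized E (g '' S) := by
  simpa using hS.image_inter isOpen_univ hg.contDiffOn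

end Basic

section Coordinates

variable {E : Type*} [NormedAddCommGroup E] [NormedSpace ℝ E]
  {ι κ : Type*} [Fintype ι] [DecidableEq ι] {S : Set (ι → ℝ)} {i : ι}

theorem slice (hS : SmoothlyParametrized E S)
    (hSi : ∀ v ∈ S, ∀ t, Function.update v i t ∈ S) (c : ℝ) :
    SmoothlyParametrized E {v ∈ S | v i = c} := by
  convert hS.image_of_contDiff (g := fun v => Function.update v i c)
    (contDiffOn_univ.1 <| contDiffOn_update i contDiffOn_id contDiffOn_const) using 1
  refine Set.Subset.antisymm (fun v ⟨hv, hc⟩ => ⟨v, hv, ?_⟩) ?_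
  · simp only [← hc, Function.update_eq_self]
  · rintro _ ⟨v, hv, rfl⟩
    exact ⟨hSi v hv c, Function.update_self ..⟩

/-- A system of equations affine in the `i`-th coordinate is solved for that coordinate wherever one
of its leading coefficients does not vanish, provided the other coordinates make it consistent. -/
theorem affine_system [Finite κ] (hSi : ∀ v ∈ S, ∀ t, Function.update v i t ∈ S)
    {p q : κ → (ι → ℝ) → ℝ} (hp : ∀ k, ContDiff ℝ ∞ (p k)) (hq : ∀ k, ContDiff ℝ ∞ (q k))
    (hpi : ∀ k v t, p k (Function.update v i t) = p k v)
    (hqi : ∀ k v t, q k (Function.update v i t) = q k v)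
    (consistent : ∀ k, SmoothlyParametrized E {v ∈ S | ∀ l, p l v * q k v = p k v * q l v})
    (degenerate : SmoothlyParametrized E {v ∈ S | ∀ k, p k v = 0 ∧ q k v = 0}) :
    SmoothlyParametrized E {v ∈ S | ∀ k, p k v * v i + q k v = 0} := by
  let solve (k : κ) (v : ι → ℝ) : ι → ℝ := Function.update v i (-q k v / p k v)
  have solved (k : κ) : SmoothlyParametrized E
      (solve k '' ({v ∈ S | ∀ l, p l v * q k v = p k v * q l v} ∩ {v | p k v ≠ 0})) := by
    have hW : IsOpen {v | p k v ≠ 0} := isOpen_ne_fun (hp k).continuous continuous_const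
    refine (consistent k).image_inter hW (contDiffOn_update i contDiffOn_id ?_)
    exact (hq k).neg.contDiffOn.div (hp k).contDiffOn fun _ hv => hv
  convert (iUnion solved).union degenerate using 1
  refine Set.Subset.antisymm (fun v ⟨hv, h⟩ => ?_)
    (Set.union_subset (Set.iUnion_subset fun k => ?_) fun v ⟨hv, h⟩ => ⟨hv, fun k => ?_⟩)
  · by_cases h0 : ∀ k, p k v = 0
    · exact .inr ⟨hv, fun k => ⟨h0 k, by simpa [h0 k] using h k⟩⟩
    · push Not at h0
      obtain ⟨k, hk⟩ := h0
      refine .inl (Set.mem_iUnion.2 ⟨k, v, ⟨⟨hv, fun l => ?_⟩, hk⟩, ?_⟩)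
      · linear_combination p l v * h k - p k v * h l
      · have hvi : -q k v / p k v = v i := by
          rw [div_eq_iff hk]
          linear_combination -h k
        simp only [solve, hvi, Function.update_eq_self]
  · rintro _ ⟨v, ⟨⟨hv, h⟩, hk : p k v ≠ 0⟩, rfl⟩
    refine ⟨hSi v hv _, fun l => ?_⟩
    simp only [solve, hpi, hqi, Function.update_self]
    field_simp
    linear_combination -h l
  · rw [(h k).1, (h k).2, zero_mul, zero_add]

theorem affine_equation (hS : SmoothlyParametrized E S)
    (hSi : ∀ v ∈ S, ∀ t, Function.update v i t ∈ S) {p q : (ι → ℝ) → ℝ} (hp : ContDiff ℝ ∞ p)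
    (hq : ContDiff ℝ ∞ q) (hpi : ∀ v t, p (Function.update v i t) = p v)
    (hqi : ∀ v t, q (Function.update v i t) = q v)
    (degenerate : SmoothlyParametrized E {v ∈ S | p v = 0 ∧ q v = 0}) :
    SmoothlyParametrized E {v ∈ S | p v * v i + q v = 0} := by
  simpa using affine_system (κ := Unit) (p := fun _ => p) (q := fun _ => q) hSi (fun _ => hp)
    (fun _ => hq) (fun _ => hpi) (fun _ => hqi) (by simpa using hS) (by simpa using degenerate)

end Coordinates

theorem eval_coordinate_eq_zero {ι κ : Type*} [Fintype ι] [Finite κ] (P : κ → Polynomial ℝ)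
    (i : ι) :
    SmoothlyParametrized (ι → ℝ) {v : ι → ℝ | ∀ k, (P k).eval (v i) = 0} := by
  classical
  by_cases h0 : ∀ k, P k = 0
  · simpa [h0] using univ
  · push Not at h0
    obtain ⟨k, hk⟩ := h0
    have hfin : {c : ℝ | ∀ k, (P k).eval c = 0}.Finite :=
      (Polynomial.finite_setOfPred_isRoot hk).subset fun c hc => hc k
    convert biUnion hfin fun c _ => univ.slice (i := i) (fun _ _ _ => Set.mem_univ _) c using 1
    ext v
    simp

end SmoothlyParametrized

/-- `f` is affine in each coordinate separately, that is, `f` agrees along every coordinate line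
with the interpolation between the points of that line with coordinate `0` and `1`. -/
def IsMultiaffine {ι : Type*} [DecidableEq ι] (f : (ι → ℝ) → ℝ) : Prop :=
  ∀ x i t, f (Function.update x i t) =
    (1 - t) * f (Function.update x i 0) + t * f (Function.update x i 1)

namespace IsMultiaffine

theorem exists_cons {n : ℕ} {f : (Fin (n + 1) → ℝ) → ℝ} (hf : IsMultiaffine f) :
    ∃ g h : (Fin n → ℝ) → ℝ, IsMultiaffine g ∧ IsMultiaffine h ∧
      ∀ t x, f (Matrix.vecCons t x) = g x + t * h x := by
  have hcons (c : ℝ) : IsMultiaffine fun x : Fin n → ℝ => f (Matrix.vecCons c x) := fun x i t => by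
    simpa only [Matrix.vecCons, Fin.cons_update] using hf (Fin.cons c x) i.succ t
  refine ⟨fun x => f (Matrix.vecCons 0 x), fun x => f (Matrix.vecCons 1 x) - f (Matrix.vecCons 0 x),
    hcons 0, fun x i t => ?_, fun t x => ?_⟩
  · linear_combination hcons 1 x i t - hcons 0 x i t
  · have h := hf (Matrix.vecCons t x) 0 t
    simp only [Matrix.vecCons, Fin.update_cons_zero] at h ⊢
    linear_combination h

theorem contDiff {n : ℕ} {f : (Fin n → ℝ) → ℝ} (hf : IsMultiaffine f) : ContDiff ℝ ∞ f := by
  induction n with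
  | zero =>
    have hf' : f = fun _ => f 0 := funext fun x => congrArg f (Subsingleton.elim x 0)
    exact hf' ▸ contDiff_const
  | succ n ih =>
    obtain ⟨g, h, hg, hh, hfgh⟩ := hf.exists_cons
    have htail : ContDiff ℝ ∞ (Fin.tail : (Fin (n + 1) → ℝ) → Fin n → ℝ) :=
      contDiff_pi.2 fun i => contDiff_apply ℝ ℝ i.succ
    have hf' : f = fun x => g (Fin.tail x) + x 0 * h (Fin.tail x) := by
      funext x
      rw [← hfgh, Matrix.vecCons, Fin.cons_self_tail]
    rw [hf']
    exact ((ih hg).comp htail).add ((contDiff_apply ℝ ℝ 0).mul ((ih hh).comp htail))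

theorem comp_perm {ι : Type*} [DecidableEq ι] {f : (ι → ℝ) → ℝ} (hf : IsMultiaffine f)
    (σ : Equiv.Perm ι) : IsMultiaffine fun x => f (x ∘ σ) := fun x i t => by
  simpa only [Function.update_comp_equiv] using hf (x ∘ σ) (σ.symm i) t

theorem smoothlyParametrized_zeros {ι κ : Type*} [Fintype ι] [Finite κ]
    {f : κ → (Fin 2 → ℝ) → ℝ} (hf : ∀ k, IsMultiaffine (f k)) {i j : ι} (hij : j ≠ i) :
    SmoothlyParametrized (ι → ℝ) {v : ι → ℝ | ∀ k, f k ![v i, v j] = 0} := by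
  classical
  choose q p hq hp hfqp using fun k => (hf k).exists_cons
  choose q₀ q₁ _ _ hq' using fun k => (hq k).exists_cons
  choose p₀ p₁ _ _ hp' using fun k => (hp k).exists_cons
  let P (k : κ) : Polynomial ℝ := .C (p₀ k ![]) + .X * .C (p₁ k ![])
  let Q (k : κ) : Polynomial ℝ := .C (q₀ k ![]) + .X * .C (q₁ k ![])
  have hf' (k : κ) (v : ι → ℝ) : f k ![v i, v j] = (P k).eval (v j) * v i + (Q k).eval (v j) := by
    simp only [hfqp, hq', hp', P, Q, Polynomial.eval_add, Polynomial.eval_mul, Polynomial.eval_C,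
      Polynomial.eval_X]
    ring
  have hsmooth (R : Polynomial ℝ) : ContDiff ℝ ∞ fun v : ι → ℝ => R.eval (v j) := by
    simpa [Function.comp_def] using (R.contDiff_aeval (𝕜 := ℝ) ∞).comp (contDiff_apply ℝ ℝ j)
  simp only [hf']
  convert SmoothlyParametrized.affine_system (S := Set.univ) (i := i)
    (p := fun k v => (P k).eval (v j)) (q := fun k v => (Q k).eval (v j))
    (fun _ _ _ => Set.mem_univ _) (fun k => hsmooth (P k)) (fun k => hsmooth (Q k))
    (fun k v t => ?_) (fun k v t => ?_) (fun k => ?_) ?_ using 1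
  · simp
  · rw [Function.update_of_ne hij]
  · rw [Function.update_of_ne hij]
  · convert SmoothlyParametrized.eval_coordinate_eq_zero (fun l => P l * Q k - P k * Q l) j using 1
    simp [sub_eq_zero]
  · convert SmoothlyParametrized.eval_coordinate_eq_zero (Sum.elim P Q) j using 1
    simp [forall_and]

end IsMultiaffine

/-- `f` restricts to an affine function of the parameter `t` on the line `t ↦ t a + b`. -/
def IsAffineAlong {n : ℕ} (f : (Fin n → ℝ) → ℝ) (a b : Fin n → ℝ) : Prop :=
  ∃ s c : ℝ, ∀ t : ℝ, f (t • a + b) = t * s + c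

theorem IsAffineAlong.reparam {n : ℕ} {f : (Fin n → ℝ) → ℝ} {a b : Fin n → ℝ}
    (h : IsAffineAlong f a b) (r s : ℝ) : IsAffineAlong f (r • a) (b + s • a) := by
  obtain ⟨m, c, h⟩ := h
  refine ⟨r * m, s * m + c, fun t => ?_⟩
  rw [show t • r • a + (b + s • a) = (t * r + s) • a + b by module, h]
  ring

theorem lineSet_reparam {n : ℕ} (a b : Fin n → ℝ) {r : ℝ} (hr : r ≠ 0) (s : ℝ) :
    lineSet (r • a) (b + s • a) = lineSet a b := by
  have hsurj : Function.Surjective fun t : ℝ => t * r + s :=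
    fun t => ⟨(t - s) / r, by simp [hr]⟩
  rw [lineSet, lineSet, ← hsurj.range_comp fun t => t • a + b]
  congr 1
  funext t
  simp only [Function.comp_apply]
  module

theorem cubic_eq_affine_iff {c₀ c₁ c₂ c₃ : ℝ} :
    (∃ s c : ℝ, ∀ t : ℝ, c₀ + c₁ * t + c₂ * t ^ 2 + c₃ * t ^ 3 = t * s + c) ↔ c₃ = 0 ∧ c₂ = 0 := by
  refine ⟨fun ⟨s, c, h⟩ => ⟨?_, ?_⟩, fun ⟨h₃, h₂⟩ => ⟨c₁, c₀, fun t => ?_⟩⟩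
  · linear_combination (h 2 - 2 * h 1 + 2 * h (-1) - h (-2)) / 12
  · linear_combination (h 1 - 2 * h 0 + h (-1)) / 2
  · rw [h₂, h₃]
    ring

/-- The line in `ℝ⁵` whose first coordinate is the parameter and whose last two coordinates are
constant: `t ↦ (t, v₂ t + v₄, v₃ t + v₅, v₀, v₁)`, given by its direction and its point at
`t = 0`. -/
def normalizedLine (v : Fin 6 → ℝ) : (Fin 5 → ℝ) × (Fin 5 → ℝ) :=
  (![1, v 2, v 3, 0, 0], ![0, v 4, v 5, v 0, v 1])

theorem IsMultiaffine.exists_isAffineAlong_normalizedLine_iff {f : (Fin 5 → ℝ) → ℝ}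
    (hf : IsMultiaffine f) :
    ∃ A B C D : (Fin 2 → ℝ) → ℝ,
      IsMultiaffine A ∧ IsMultiaffine B ∧ IsMultiaffine C ∧ IsMultiaffine D ∧
      ∀ v, IsAffineAlong f (normalizedLine v).1 (normalizedLine v).2 ↔
        A ![v 0, v 1] * v 2 * v 3 = 0 ∧
        A ![v 0, v 1] * (v 4 * v 3 + v 5 * v 2) + B ![v 0, v 1] * v 2 + C ![v 0, v 1] * v 3 +
          D ![v 0, v 1] * v 2 * v 3 = 0 := by
  obtain ⟨f₀, f₁, hf₀, hf₁, hf⟩ := hf.exists_cons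
  obtain ⟨f₀₀, f₀₁, hf₀₀, hf₀₁, hf₀⟩ := hf₀.exists_cons
  obtain ⟨f₁₀, f₁₁, hf₁₀, hf₁₁, hf₁⟩ := hf₁.exists_cons
  obtain ⟨f₀₀₀, f₀₀₁, -, -, hf₀₀⟩ := hf₀₀.exists_cons
  obtain ⟨f₀₁₀, D, -, hD, hf₀₁⟩ := hf₀₁.exists_cons
  obtain ⟨f₁₀₀, C, -, hC, hf₁₀⟩ := hf₁₀.exists_cons
  obtain ⟨B, A, hB, hA, hf₁₁⟩ := hf₁₁.exists_cons
  refine ⟨A, B, C, D, hA, hB, hC, hD, fun v => ?_⟩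
  have hline (t : ℝ) : t • (normalizedLine v).1 + (normalizedLine v).2 =
      ![t, t * v 2 + v 4, t * v 3 + v 5, v 0, v 1] := by
    simp [normalizedLine]
  generalize ![v 0, v 1] = z at hline ⊢
  have hcubic (t : ℝ) : f (t • (normalizedLine v).1 + (normalizedLine v).2) =
      (f₀₀₀ z + v 5 * f₀₀₁ z + v 4 * (f₀₁₀ z + v 5 * D z)) +
      (v 3 * f₀₀₁ z + v 2 * (f₀₁₀ z + v 5 * D z) + v 4 * v 3 * D z +
        f₁₀₀ z + v 5 * C z + v 4 * (B z + v 5 * A z)) * t +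
      (A z * (v 4 * v 3 + v 5 * v 2) + B z * v 2 + C z * v 3 + D z * v 2 * v 3) * t ^ 2 +
      A z * v 2 * v 3 * t ^ 3 := by
    simp only [hline, hf, hf₀, hf₁, hf₀₀, hf₀₁, hf₁₀, hf₁₁]
    ring
  simp only [IsAffineAlong, hcubic, cubic_eq_affine_iff]

section CubicSystem

variable {A B C D : (Fin 2 → ℝ) → ℝ}

theorem smoothlyParametrized_zeros_and_affine_equation {κ : Type*} [Finite κ]
    {H : κ → (Fin 2 → ℝ) → ℝ} {p q : (Fin 2 → ℝ) → ℝ} (hH : ∀ k, IsMultiaffine (H k))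
    (hp : IsMultiaffine p) (hq : IsMultiaffine q) {i : Fin 6} (hi₀ : 0 ≠ i) (hi₁ : 1 ≠ i) :
    SmoothlyParametrized (Fin 6 → ℝ) {v : Fin 6 → ℝ |
      (∀ k, H k ![v 0, v 1] = 0) ∧ p ![v 0, v 1] * v i + q ![v 0, v 1] = 0} := by
  have hp' := hp.contDiff
  have hq' := hq.contDiff
  have degenerate := IsMultiaffine.smoothlyParametrized_zeros (ι := Fin 6) (i := 0) (j := 1)
    (f := Sum.elim H ![p, q]) (by simp [hH, hp, hq, Fin.forall_fin_two]) (by decide)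
  exact .affine_equation (IsMultiaffine.smoothlyParametrized_zeros hH (by decide))
    (by simp [hi₀, hi₁]) (by fun_prop) (by fun_prop) (by simp [hi₀, hi₁]) (by simp [hi₀, hi₁])
    (by simpa [Fin.forall_fin_two] using degenerate)

theorem smoothlyParametrized_consistent_cubic_system (hA : IsMultiaffine A)
    (hC : IsMultiaffine C) :
    SmoothlyParametrized (Fin 6 → ℝ) {v : Fin 6 → ℝ |
      (A ![v 0, v 1] = 0 ∨ v 3 = 0) ∨ A ![v 0, v 1] * v 4 + C ![v 0, v 1] = 0} := by
  have hA₀ : SmoothlyParametrized (Fin 6 → ℝ) {v : Fin 6 → ℝ | A ![v 0, v 1] = 0} := by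
    simpa using IsMultiaffine.smoothlyParametrized_zeros (ι := Fin 6) (i := 0) (j := 1)
      (f := ![A]) (by simp [hA]) (by decide)
  have hβ₀ : SmoothlyParametrized (Fin 6 → ℝ) {v : Fin 6 → ℝ | v 3 = 0} := by
    simpa using SmoothlyParametrized.univ.slice (i := (3 : Fin 6)) (by simp) 0
  have hAC : SmoothlyParametrized (Fin 6 → ℝ)
      {v : Fin 6 → ℝ | A ![v 0, v 1] * v 4 + C ![v 0, v 1] = 0} := by
    simpa using smoothlyParametrized_zeros_and_affine_equation (H := ![]) (by simp) hA hC (i := 4)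
      (by decide) (by decide)
  exact (hA₀.union hβ₀).union hAC

theorem smoothlyParametrized_degenerate_cubic_system (hA : IsMultiaffine A)
    (hB : IsMultiaffine B) (hC : IsMultiaffine C) (hD : IsMultiaffine D) :
    SmoothlyParametrized (Fin 6 → ℝ) {v : Fin 6 → ℝ |
      A ![v 0, v 1] * v 3 = 0 ∧ A ![v 0, v 1] * v 5 + B ![v 0, v 1] + D ![v 0, v 1] * v 3 = 0 ∧
      v 3 * (A ![v 0, v 1] * v 4 + C ![v 0, v 1]) = 0} := by
  have hβ : SmoothlyParametrized (Fin 6 → ℝ)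
      {v : Fin 6 → ℝ | A ![v 0, v 1] * v 5 + B ![v 0, v 1] = 0 ∧ v 3 = 0} := by
    have h := smoothlyParametrized_zeros_and_affine_equation (H := ![]) (by simp) hA hB (i := 5)
      (by decide) (by decide)
    simpa using h.slice (i := 3) (by simp) 0
  have hAC : SmoothlyParametrized (Fin 6 → ℝ) {v : Fin 6 → ℝ |
      (A ![v 0, v 1] = 0 ∧ C ![v 0, v 1] = 0) ∧ D ![v 0, v 1] * v 3 + B ![v 0, v 1] = 0} := by
    simpa [Fin.forall_fin_two] using smoothlyParametrized_zeros_and_affine_equation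
      (H := ![A, C]) (by simp [Fin.forall_fin_two, hA, hC]) hD hB (i := 3) (by decide) (by decide)
  convert hβ.union hAC using 1
  ext v
  simp only [Set.mem_ofPred_eq, Set.mem_union]
  grind

theorem smoothlyParametrized_cubic_system (hA : IsMultiaffine A) (hB : IsMultiaffine B)
    (hC : IsMultiaffine C) (hD : IsMultiaffine D) :
    SmoothlyParametrized (Fin 6 → ℝ) {v : Fin 6 → ℝ |
      A ![v 0, v 1] * v 2 * v 3 = 0 ∧
      A ![v 0, v 1] * (v 4 * v 3 + v 5 * v 2) + B ![v 0, v 1] * v 2 + C ![v 0, v 1] * v 3 +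
        D ![v 0, v 1] * v 2 * v 3 = 0} := by
  have hA' := hA.contDiff
  have hB' := hB.contDiff
  have hC' := hC.contDiff
  have hD' := hD.contDiff
  -- Both equations are affine in `v 2`, with leading coefficients `p` and constant terms `q`.
  let p : Fin 2 → (Fin 6 → ℝ) → ℝ := ![fun v => A ![v 0, v 1] * v 3,
    fun v => A ![v 0, v 1] * v 5 + B ![v 0, v 1] + D ![v 0, v 1] * v 3]
  let q : Fin 2 → (Fin 6 → ℝ) → ℝ :=
    ![fun _ => 0, fun v => v 3 * (A ![v 0, v 1] * v 4 + C ![v 0, v 1])]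
  have hp : ∀ k, ContDiff ℝ ∞ (p k) := Fin.forall_fin_two.2
    ⟨by dsimp [p]; fun_prop, by dsimp [p]; fun_prop⟩
  have hq : ∀ k, ContDiff ℝ ∞ (q k) := Fin.forall_fin_two.2
    ⟨by dsimp [q]; fun_prop, by dsimp [q]; fun_prop⟩
  convert SmoothlyParametrized.affine_system (S := Set.univ) (i := (2 : Fin 6)) (by simp) hp hq
    (by simp [p]) (by simp [q]) (fun k => ?_) ?_ using 1
  · ext v
    simp only [p, q, Fin.forall_fin_two, Matrix.cons_val_zero, Matrix.cons_val_one,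
      Set.mem_ofPred_eq, Set.mem_univ, true_and]
    ring_nf
  · convert smoothlyParametrized_consistent_cubic_system hA hC using 1
    ext v
    fin_cases k <;> simp [p, q, Fin.forall_fin_two, or_assoc]
  · convert smoothlyParametrized_degenerate_cubic_system hA hB hC hD using 1
    ext v
    simp only [p, q, Fin.forall_fin_two, Matrix.cons_val_zero, Matrix.cons_val_one,
      Set.mem_ofPred_eq, Set.mem_univ, true_and, and_true]

end CubicSystem

theorem smoothlyParametrized_isAffineAlong_normalizedLine {f : (Fin 5 → ℝ) → ℝ}
    (hf : IsMultiaffine f) :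
    SmoothlyParametrized (Fin 6 → ℝ)
      {v | IsAffineAlong f (normalizedLine v).1 (normalizedLine v).2} := by
  obtain ⟨A, B, C, D, hA, hB, hC, hD, hiff⟩ := hf.exists_isAffineAlong_normalizedLine_iff
  simpa only [hiff] using smoothlyParametrized_cubic_system hA hB hC hD

/-- The lines in `ℝⁿ` along which `f` is affine, each given by a direction and a point. -/
def affineLines {n : ℕ} (f : (Fin n → ℝ) → ℝ) : Set ((Fin n → ℝ) × (Fin n → ℝ)) :=
  {p | p.1 ≠ 0 ∧ IsAffineAlong f p.1 p.2}

/-- Lines along which `f` is affine, obtained from lines in the normal form `normalizedLine` by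
permuting the coordinates. -/
def permutedAffineLines (f : (Fin 5 → ℝ) → ℝ) (σ : Equiv.Perm (Fin 5)) :
    Set ((Fin 5 → ℝ) × (Fin 5 → ℝ)) :=
  (fun v => ((normalizedLine v).1 ∘ σ, (normalizedLine v).2 ∘ σ)) ''
    {v | IsAffineAlong (fun x => f (x ∘ σ)) (normalizedLine v).1 (normalizedLine v).2}

theorem smoothlyParametrized_permutedAffineLines {f : (Fin 5 → ℝ) → ℝ} (hf : IsMultiaffine f)
    (σ : Equiv.Perm (Fin 5)) : SmoothlyParametrized (Fin 6 → ℝ) (permutedAffineLines f σ) := by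
  refine (smoothlyParametrized_isAffineAlong_normalizedLine (hf.comp_perm σ)).image_of_contDiff ?_
  have hperm : ContDiff ℝ ∞ fun x : Fin 5 → ℝ => x ∘ σ :=
    contDiff_pi.2 fun i => contDiff_apply ℝ ℝ (σ i)
  exact (hperm.comp (by unfold normalizedLine; fun_prop)).prodMk
    (hperm.comp (by unfold normalizedLine; fun_prop))

theorem permutedAffineLines_subset (f : (Fin 5 → ℝ) → ℝ) (σ : Equiv.Perm (Fin 5)) :
    permutedAffineLines f σ ⊆ affineLines f := by
  rintro _ ⟨v, h, rfl⟩
  refine ⟨fun h0 => ?_, h⟩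
  simpa [normalizedLine] using congrFun h0 (σ.symm 0)

theorem exists_perm_normalizedLine {a b : Fin 5 → ℝ} {i j k : Fin 5} (hij : i ≠ j)
    (hi : a i = 0) (hj : a j = 0) (hak : a k = 1) (hbk : b k = 0) :
    ∃ (σ : Equiv.Perm (Fin 5)) (v : Fin 6 → ℝ),
      (normalizedLine v).1 ∘ σ = a ∧ (normalizedLine v).2 ∘ σ = b := by
  have hki : k ≠ i := by
    rintro rfl
    simp [hi] at hak
  have hkj : k ≠ j := by
    rintro rfl
    simp [hj] at hak
  have hinj : Function.Injective ![k, i, j] := List.nodup_ofFn.1 (by simp [hki, hkj, hij])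
  obtain ⟨σ, hσ⟩ :=
    Equiv.Perm.exists_extending_pair ![(0 : Fin 5), 3, 4] ![k, i, j] (by decide) hinj
  have hσ₀ : σ 0 = k := hσ 0
  have hσ₃ : σ 3 = i := hσ 1
  have hσ₄ : σ 4 = j := hσ 2
  refine ⟨σ.symm, ![b i, b j, a (σ 1), a (σ 2), b (σ 1), b (σ 2)], ?_, ?_⟩ <;>
  · rw [Equiv.comp_symm_eq]
    funext l
    fin_cases l <;> simp [normalizedLine, *]

theorem exists_permutedAffineLines_lineSet_eq {f : (Fin 5 → ℝ) → ℝ} {p : (Fin 5 → ℝ) × (Fin 5 → ℝ)}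
    (hp : p ∈ affineLines f) {i j : Fin 5} (hij : i ≠ j) (hi : p.1 i = 0) (hj : p.1 j = 0) :
    ∃ σ, ∃ p' ∈ permutedAffineLines f σ, lineSet p'.1 p'.2 = lineSet p.1 p.2 := by
  obtain ⟨a, b⟩ := p
  obtain ⟨ha, hf⟩ := hp
  obtain ⟨k, hk : a k ≠ 0⟩ := Function.ne_iff.1 ha
  let r := (a k)⁻¹
  let s := -(b k / a k)
  obtain ⟨σ, v, ha', hb'⟩ := exists_perm_normalizedLine (a := r • a) (b := b + s • a) (k := k) hij
    (by simp_all) (by simp_all) (by simp [r, hk]) (by simp [s, hk])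
  have hv : IsAffineAlong f ((normalizedLine v).1 ∘ σ) ((normalizedLine v).2 ∘ σ) := by
    rw [ha', hb']
    exact hf.reparam r s
  refine ⟨σ, _, ⟨v, hv, rfl⟩, ?_⟩
  simp only [ha', hb']
  exact lineSet_reparam a b (inv_ne_zero hk) s

theorem SmoothlyParametrized.dependsOnAtMost {k n : ℕ} {S : Set ((Fin n → ℝ) × (Fin n → ℝ))}
    (hS : SmoothlyParametrized (Fin k → ℝ) S) (h0 : ∀ p ∈ S, p.1 ≠ 0) :
    DependsOnAtMost ((fun p => lineSet p.1 p.2) '' S) k := by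
  induction hS with
  | empty => exact ⟨0, fun _ => ∅, fun _ _ => 0, fun _ _ => 0, fun j => j.elim0, by simp⟩
  | @image U f hU hf =>
    refine ⟨1, fun _ => U, fun _ u => (f u).1, fun _ u => (f u).2, fun _ => ⟨hU, ?_, ?_, ?_⟩, ?_⟩
    · exact contDiff_fst.comp_contDiffOn hf
    · exact contDiff_snd.comp_contDiffOn hf
    · exact fun u hu => h0 _ (Set.mem_image_of_mem _ hu)
    · simp [Set.image_image, Set.iUnion_const]
  | union _ _ ihS ihT =>
    obtain ⟨m, U, a, b, h, e⟩ := ihS fun p hp => h0 p (Or.inl hp)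
    obtain ⟨m', U', a', b', h', e'⟩ := ihT fun p hp => h0 p (Or.inr hp)
    refine ⟨m + m', Fin.append U U', Fin.append a a', Fin.append b b',
      Fin.addCases (by simpa using h) (by simpa using h'), ?_⟩
    rw [Set.image_union, e, e', ← finSumFinEquiv.surjective.iUnion_comp, Set.iUnion_sum]
    simp

/-- The graph of `f` in `ℝⁿ⁺¹`, with the value of `f` as the last coordinate. -/
def graphSet {n : ℕ} (f : (Fin n → ℝ) → ℝ) : Set (Fin (n + 1) → ℝ) :=
  {x | x (Fin.last n) = f (Fin.init x)}

/-- The line through the points of the graph of `f` over `b` and `a + b`, where the pair `(a, b)` of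
a direction and a point stands for a line in `ℝⁿ`. -/
def graphLift {n : ℕ} (f : (Fin n → ℝ) → ℝ) (p : (Fin n → ℝ) × (Fin n → ℝ)) :
    (Fin (n + 1) → ℝ) × (Fin (n + 1) → ℝ) :=
  (Fin.snoc p.1 (f (p.1 + p.2) - f p.2), Fin.snoc p.2 (f p.2))

section Graph

variable {n : ℕ} {f : (Fin n → ℝ) → ℝ}

theorem graphLift_fst_eq_zero_iff {p : (Fin n → ℝ) × (Fin n → ℝ)} :
    (graphLift f p).1 = 0 ↔ p.1 = 0 := by
  refine ⟨fun h => funext fun i => ?_, fun h => funext (Fin.lastCases ?_ fun i => ?_)⟩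
  · simpa [graphLift] using congrFun h i.castSucc
  · simp [graphLift, h]
  · simp [graphLift, h]

theorem contDiff_graphLift (hf : ContDiff ℝ ∞ f) : ContDiff ℝ ∞ (graphLift f) := by
  unfold graphLift
  fun_prop

theorem smul_graphLift_add {p : (Fin n → ℝ) × (Fin n → ℝ)} (hp : IsAffineAlong f p.1 p.2) (t : ℝ) :
    t • (graphLift f p).1 + (graphLift f p).2 =
      Fin.snoc (t • p.1 + p.2) (f (t • p.1 + p.2)) := by
  obtain ⟨s, c, h⟩ := hp
  have h₀ := h 0
  have h₁ := h 1
  simp only [zero_smul, one_smul, zero_add, zero_mul, one_mul] at h₀ h₁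
  funext i
  induction i using Fin.lastCases with
  | last => simp [graphLift, h, h₀, h₁]
  | cast i => simp [graphLift]

theorem lineSet_graphLift {p : (Fin n → ℝ) × (Fin n → ℝ)} (hp : IsAffineAlong f p.1 p.2) :
    lineSet (graphLift f p).1 (graphLift f p).2 =
      (fun x => (Fin.snoc x (f x) : Fin (n + 1) → ℝ)) '' lineSet p.1 p.2 := by
  simp only [lineSet, smul_graphLift_add hp, ← Set.range_comp, Function.comp_def]

theorem linesIn_graphSet :
    linesIn (graphSet f) =
      (fun p => lineSet (graphLift f p).1 (graphLift f p).2) '' affineLines f := by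
  refine Set.Subset.antisymm ?_ ?_
  · rintro _ ⟨⟨a, b, ha, rfl⟩, hab⟩
    have hf (t : ℝ) : f (t • Fin.init a + Fin.init b) = t * a (Fin.last n) + b (Fin.last n) :=
      (hab ⟨t, rfl⟩).symm
    have hf₀ : f (Fin.init b) = b (Fin.last n) := by simpa using hf 0
    have hf₁ : f (Fin.init a + Fin.init b) = a (Fin.last n) + b (Fin.last n) := by simpa using hf 1
    have hlift : graphLift f (Fin.init a, Fin.init b) = (a, b) := by
      simp only [graphLift, hf₀, hf₁, add_sub_cancel_right, Fin.snoc_init_self]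
    have hinit : Fin.init a ≠ 0 := by
      rwa [Ne, ← graphLift_fst_eq_zero_iff (p := (Fin.init a, Fin.init b)), hlift]
    exact ⟨(Fin.init a, Fin.init b), ⟨hinit, _, _, hf⟩, by simp only [hlift]⟩
  · rintro _ ⟨p, ⟨hp₀, hp⟩, rfl⟩
    refine ⟨⟨_, _, graphLift_fst_eq_zero_iff.not.2 hp₀, rfl⟩, ?_⟩
    simp only [lineSet_graphLift hp, Set.image_subset_iff]
    intro x _
    simp [graphSet]

theorem dependsOnAtMost_linesIn_graphSet {k : ℕ} (hf : ContDiff ℝ ∞ f)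
    {S : Set ((Fin n → ℝ) × (Fin n → ℝ))} (hS : SmoothlyParametrized (Fin k → ℝ) S)
    (hSf : S ⊆ affineLines f)
    (cover : ∀ p ∈ affineLines f, ∃ p' ∈ S, lineSet p'.1 p'.2 = lineSet p.1 p.2) :
    DependsOnAtMost (linesIn (graphSet f)) k := by
  convert (hS.image_of_contDiff (contDiff_graphLift hf)).dependsOnAtMost ?_
  · rw [linesIn_graphSet, Set.image_image]
    refine Set.Subset.antisymm ?_ (Set.image_mono hSf)
    rintro _ ⟨p, hp, rfl⟩
    obtain ⟨p', hp', h⟩ := cover p hp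
    exact ⟨p', hp', by simp only [lineSet_graphLift hp.2, lineSet_graphLift (hSf hp').2, h]⟩
  · rintro _ ⟨p, hp, rfl⟩
    exact graphLift_fst_eq_zero_iff.not.2 (hSf hp).1

end Graph

/-- The reliability of the bridge network as a function of the reliabilities of its components. -/
noncomputable def reliability (x : Fin 5 → ℝ) : ℝ :=
  MvPolynomial.eval x bridgePolynomial

theorem reliabilityHypersurface_eq_graphSet : reliabilityHypersurface = graphSet reliability :=
  rfl

theorem reliability_eq (x : Fin 5 → ℝ) :
    reliability x = x 0 * x 3 + x 1 * x 4 - x 0 * x 1 * x 3 * x 4 +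
      x 1 * x 2 * x 3 * (1 - x 0) * (1 - x 4) := by
  simp only [reliability, bridgePolynomial, map_add, map_sub, map_mul, MvPolynomial.eval_X]
  ring

theorem isMultiaffine_reliability : IsMultiaffine reliability := fun x i t => by
  simp only [reliability_eq]
  fin_cases i <;>
  · simp only [Function.update_apply, Fin.reduceFinMk, Fin.reduceEq, if_true, if_false]
    ring

theorem reliability_comp_rev (x : Fin 5 → ℝ) : reliability (x ∘ Fin.rev) = reliability x := by
  rw [reliability_eq, reliability_eq]
  simp only [Function.comp_apply, Fin.reduceRev]
  ring

section Classification

/- If a polynomial in `t` of degree at most `n`, with `n ≥ 2`, is an affine function, then its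
`n`-th finite difference is at once `n!` times the coefficient of `tⁿ` and `0`. -/

variable {a b : Fin 5 → ℝ}

theorem IsAffineAlong.reliability_comp_rev (h : IsAffineAlong reliability a b) :
    IsAffineAlong reliability (a ∘ Fin.rev) (b ∘ Fin.rev) := by
  obtain ⟨s, c, h⟩ := h
  exact ⟨s, c, fun t => (_root_.reliability_comp_rev (t • a + b)).trans (h t)⟩

theorem exists_direction_eq_zero (h : IsAffineAlong reliability a b) : ∃ i, a i = 0 := by
  obtain ⟨s, c, h⟩ := h
  simp only [reliability_eq, Pi.add_apply, Pi.smul_apply, smul_eq_mul] at h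
  have quintic : a 0 * a 1 * a 2 * a 3 * a 4 = 0 := by
    linear_combination (h 5 - 5 * h 4 + 10 * h 3 - 10 * h 2 + 5 * h 1 - h 0) / 120
  by_contra! hne
  simp [hne] at quintic

theorem exists_direction_eq_zero_of_zero (h : IsAffineAlong reliability a b) (h₀ : a 0 = 0) :
    ∃ j, j ≠ 0 ∧ a j = 0 := by
  obtain ⟨s, c, h⟩ := h
  by_contra! hne
  simp only [reliability_eq, Pi.add_apply, Pi.smul_apply, smul_eq_mul, h₀] at h
  have quartic : a 1 * a 2 * a 3 * a 4 * (b 0 - 1) = 0 := by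
    linear_combination (h 4 - 4 * h 3 + 6 * h 2 - 4 * h 1 + h 0) / 24
  have hb : b 0 = 1 := by simpa [hne, sub_eq_zero] using quartic
  have cubic : a 1 * a 3 * a 4 = 0 := by
    simp only [hb] at h
    linear_combination -(h 3 - 3 * h 2 + 3 * h 1 - h 0) / 6
  simp [hne] at cubic

theorem exists_direction_eq_zero_of_one (h : IsAffineAlong reliability a b) (h₁ : a 1 = 0) :
    ∃ j, j ≠ 1 ∧ a j = 0 := by
  obtain ⟨s, c, h⟩ := h
  by_contra! hne
  simp only [reliability_eq, Pi.add_apply, Pi.smul_apply, smul_eq_mul, h₁] at h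
  have quartic : a 0 * a 2 * a 3 * a 4 * b 1 = 0 := by
    linear_combination (h 4 - 4 * h 3 + 6 * h 2 - 4 * h 1 + h 0) / 24
  have hb : b 1 = 0 := by simpa [hne] using quartic
  have quadratic : a 0 * a 3 = 0 := by
    simp only [hb] at h
    linear_combination (h 2 - 2 * h 1 + h 0) / 2
  simp [hne] at quadratic

theorem exists_two_direction_eq_zero_or (h : IsAffineAlong reliability a b) :
    (∃ i j, i ≠ j ∧ a i = 0 ∧ a j = 0) ∨ a 2 = 0 ∧ ∀ j ≠ 2, a j ≠ 0 := by
  refine or_iff_not_imp_right.2 fun hmid => ?_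
  obtain ⟨i, hi⟩ := exists_direction_eq_zero h
  suffices ∃ j, j ≠ i ∧ a j = 0 from
    let ⟨j, hj, hj₀⟩ := this
    ⟨j, i, hj, hj₀, hi⟩
  fin_cases i
  · exact exists_direction_eq_zero_of_zero h hi
  · exact exists_direction_eq_zero_of_one h hi
  · by_contra! hne
    exact hmid ⟨hi, hne⟩
  · obtain ⟨j, hj, hj₀⟩ := exists_direction_eq_zero_of_one h.reliability_comp_rev hi
    exact ⟨j.rev, Fin.rev_eq_iff.not.2 hj, hj₀⟩
  · obtain ⟨j, hj, hj₀⟩ := exists_direction_eq_zero_of_zero h.reliability_comp_rev hi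
    exact ⟨j.rev, Fin.rev_eq_iff.not.2 hj, hj₀⟩

end Classification

/-- The lines `t ↦ (u₀ t + u₃, u₁ t + u₄, 1, u₂ t + u₅, -u₀ t + b₅)` on which the bridge component
is perfect, `b₅` being the value for which the reliability is affine along the line. -/
noncomputable def perfectBridgeLine (u : Fin 6 → ℝ) : (Fin 5 → ℝ) × (Fin 5 → ℝ) :=
  (![u 0, u 1, 0, u 2, -u 0],
    ![u 3, u 4, 1, u 5, 1 - u 3 + u 0 * (u 2 - u 1) / (u 1 * u 2)])

theorem smoothlyParametrized_perfectBridgeLine :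
    SmoothlyParametrized (Fin 6 → ℝ) (perfectBridgeLine '' {u | u 0 * (u 1 * u 2) ≠ 0}) := by
  refine .image (isOpen_ne_fun (by fun_prop) continuous_const) ?_
  unfold perfectBridgeLine
  fun_prop (disch := exact fun _ h => right_ne_zero_of_mul h)

theorem isAffineAlong_perfectBridgeLine {u : Fin 6 → ℝ} (hu : u 0 * (u 1 * u 2) ≠ 0) :
    IsAffineAlong reliability (perfectBridgeLine u).1 (perfectBridgeLine u).2 := by
  obtain ⟨-, hu₁, hu₂⟩ : u 0 ≠ 0 ∧ u 1 ≠ 0 ∧ u 2 ≠ 0 := by simpa using hu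
  -- The constant value of `1 - x₀ - x₄` on the line.
  let e := -u 0 * (u 2 - u 1) / (u 1 * u 2)
  refine ⟨u 0 * u 5 + u 2 * u 3 + u 1 * (1 - u 3 - e) - u 0 * u 4 + e * (u 1 * u 5 + u 2 * u 4),
    u 3 * u 5 + u 4 * (1 - u 3 - e) + e * u 4 * u 5, fun t => ?_⟩
  simp only [reliability_eq, perfectBridgeLine, Pi.add_apply, Pi.smul_apply, smul_eq_mul,
    Matrix.cons_val, e]
  field_simp
  ring

theorem mem_image_perfectBridgeLine {a b : Fin 5 → ℝ} (h : IsAffineAlong reliability a b)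
    (h₂ : a 2 = 0) (hne : ∀ j ≠ 2, a j ≠ 0) :
    (a, b) ∈ perfectBridgeLine '' {u | u 0 * (u 1 * u 2) ≠ 0} := by
  obtain ⟨s, c, h⟩ := h
  simp only [reliability_eq, Pi.add_apply, Pi.smul_apply, smul_eq_mul, h₂] at h
  have quartic : a 0 * a 1 * a 3 * a 4 * (b 2 - 1) = 0 := by
    linear_combination (h 4 - 4 * h 3 + 6 * h 2 - 4 * h 1 + h 0) / 24
  have hb₂ : b 2 = 1 := by simpa [hne, sub_eq_zero] using quartic
  simp only [hb₂] at h
  have cubic : a 1 * a 3 * (a 0 + a 4) = 0 := by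
    linear_combination -(h 3 - 3 * h 2 + 3 * h 1 - h 0) / 6
  have ha₄ : a 4 = -a 0 := by simpa [hne, eq_neg_iff_add_eq_zero, add_comm] using cubic
  simp only [ha₄] at h
  have quadratic : a 0 * a 3 - a 0 * a 1 + a 1 * a 3 * (1 - b 0 - b 4) = 0 := by
    linear_combination (h 2 - 2 * h 1 + h 0) / 2
  have h₁ := hne 1 (by decide)
  have h₃ := hne 3 (by decide)
  have hb₄ : b 4 = 1 - b 0 + a 0 * (a 3 - a 1) / (a 1 * a 3) := by
    field_simp
    linear_combination -quadratic
  refine ⟨![a 0, a 1, a 3, b 0, b 1, b 3], by simp [hne], ?_⟩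
  ext i <;> fin_cases i <;> simp [perfectBridgeLine, *]

theorem dependsOnAtMost_six : DependsOnAtMost (linesIn reliabilityHypersurface) 6 := by
  rw [reliabilityHypersurface_eq_graphSet]
  refine dependsOnAtMost_linesIn_graphSet isMultiaffine_reliability.contDiff
    ((SmoothlyParametrized.iUnion fun σ => smoothlyParametrized_permutedAffineLines
      isMultiaffine_reliability σ).union smoothlyParametrized_perfectBridgeLine)
    (Set.union_subset (Set.iUnion_subset (permutedAffineLines_subset reliability)) ?_) ?_
  · rintro _ ⟨u, hu, rfl⟩
    refine ⟨fun h0 => ?_, isAffineAlong_perfectBridgeLine hu⟩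
    exact left_ne_zero_of_mul hu (congrFun h0 0)
  · intro p hp
    rcases exists_two_direction_eq_zero_or hp.2 with ⟨i, j, hij, hi, hj⟩ | ⟨h₂, hne⟩
    · obtain ⟨σ, p', hp', h⟩ := exists_permutedAffineLines_lineSet_eq hp hij hi hj
      exact ⟨p', .inl (Set.mem_iUnion.2 ⟨σ, hp'⟩), h⟩
    · exact ⟨p, .inr (mem_image_perfectBridgeLine hp.2 h₂ hne), rfl⟩

theorem eq_of_lineSet_eq {n : ℕ} {a b a' b' : Fin n → ℝ} (h : lineSet a b = lineSet a' b')
    (φ : (Fin n → ℝ) →ₗ[ℝ] ℝ) (ha : φ a = 1) (hb : φ b = 0) (ha' : φ a' = 1) (hb' : φ b' = 0) :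
    a = a' ∧ b = b' := by
  have hpoint (t : ℝ) : t • a + b = t • a' + b' := by
    obtain ⟨s, hs : s • a' + b' = t • a + b⟩ : t • a + b ∈ lineSet a' b' := h ▸ ⟨t, rfl⟩
    have hst : s = t := by simpa [ha, hb, ha', hb'] using congrArg φ hs
    rw [← hs, hst]
  have hbb' : b = b' := by simpa using hpoint 0
  exact ⟨by simpa [hbb'] using hpoint 1, hbb'⟩

theorem map_fderiv_eq_zero {E F G : Type*} [NormedAddCommGroup E] [NormedSpace ℝ E]
    [NormedAddCommGroup F] [NormedSpace ℝ F] [NormedAddCommGroup G] [NormedSpace ℝ G] {U : Set E}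
    (hU : IsOpen U) {f : E → F} (hf : DifferentiableOn ℝ f U) (φ : F →L[ℝ] G) {c : G}
    (hφ : ∀ u ∈ U, φ (f u) = c) {u : E} (hu : u ∈ U) (w : E) : φ (fderiv ℝ f u w) = 0 := by
  have hfu : HasFDerivAt f (fderiv ℝ f u) u := (hf.differentiableAt (hU.mem_nhds hu)).hasFDerivAt
  have hconst : HasFDerivAt (φ ∘ f) (0 : E →L[ℝ] G) u :=
    (hasFDerivAt_const c u).congr_of_eventuallyEq (Filter.eventuallyEq_of_mem (hU.mem_nhds hu) hφ)
  exact DFunLike.congr_fun ((φ.hasFDerivAt.comp u hfu).unique hconst) w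

/-- The normalization `φ (a u) = 1`, `φ (b u) = 0` makes a line determine its pair `(a u, b u)`. -/
theorem hasEssentialParameters_of_leftInverse {k n : ℕ} {U : Set (Fin k → ℝ)}
    {a b : (Fin k → ℝ) → (Fin n → ℝ)} (hU : IsOpen U) (ha : DifferentiableOn ℝ a U)
    (hb : DifferentiableOn ℝ b U) (φ : (Fin n → ℝ) →L[ℝ] ℝ) (hφa : ∀ u ∈ U, φ (a u) = 1)
    (hφb : ∀ u ∈ U, φ (b u) = 0) {r : (Fin n → ℝ) × (Fin n → ℝ) → Fin k → ℝ}
    (hr : Differentiable ℝ r) (hrab : ∀ u ∈ U, r (a u, b u) = u) :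
    HasEssentialParameters U a b where
  injOn u hu u' hu' h := by
    obtain ⟨haa', hbb'⟩ :=
      eq_of_lineSet_eq h φ.toLinearMap (hφa u hu) (hφb u hu) (hφa u' hu') (hφb u' hu')
    rw [← hrab u hu, haa', hbb', hrab u' hu']
  full_rank u hu w hwa hwb := by
    have eq_zero_of_mem_span {x : Fin n → ℝ} (hx : x ∈ Submodule.span ℝ {a u}) (hφx : φ x = 0) :
        x = 0 := by
      obtain ⟨t, rfl⟩ := Submodule.mem_span_singleton.1 hx
      have ht : t = 0 := by simpa [hφa u hu] using hφx
      rw [ht, zero_smul]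
    have hwa₀ := eq_zero_of_mem_span hwa (map_fderiv_eq_zero hU ha φ hφa hu w)
    have hwb₀ := eq_zero_of_mem_span hwb (map_fderiv_eq_zero hU hb φ hφb hu w)
    have hnhds := hU.mem_nhds hu
    have hab : HasFDerivAt (fun u => (a u, b u)) ((fderiv ℝ a u).prod (fderiv ℝ b u)) u :=
      (ha.differentiableAt hnhds).hasFDerivAt.prodMk (hb.differentiableAt hnhds).hasFDerivAt
    have hid : HasFDerivAt (fun u => r (a u, b u)) (.id ℝ (Fin k → ℝ)) u :=
      (hasFDerivAt_id u).congr_of_eventuallyEq (Filter.eventuallyEq_of_mem hnhds hrab)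
    have hchain : fderiv ℝ r (a u, b u) (fderiv ℝ a u w, fderiv ℝ b u w) = w :=
      DFunLike.congr_fun (((hr _).hasFDerivAt.comp u hab).unique hid) w
    rw [← hchain, hwa₀, hwb₀, Prod.mk_zero_zero, map_zero]

theorem dependsOnAtLeast_five : DependsOnAtLeast (linesIn reliabilityHypersurface) 5 := by
  -- If the second component fails, the reliability is `x₀ x₃`; here `x₃` is the constant `u 2`.
  let a (u : Fin 5 → ℝ) : Fin 6 → ℝ := ![1, 0, u 0, 0, u 1, u 2]
  let b (u : Fin 5 → ℝ) : Fin 6 → ℝ := ![0, 0, u 3, u 2, u 4, 0]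
  let r (p : (Fin 6 → ℝ) × (Fin 6 → ℝ)) : Fin 5 → ℝ := ![p.1 2, p.1 4, p.1 5, p.2 2, p.2 4]
  have ha : ContDiff ℝ ∞ a := by fun_prop
  have hb : ContDiff ℝ ∞ b := by fun_prop
  have hr : ContDiff ℝ ∞ r := by fun_prop
  have ha₀ (u : Fin 5 → ℝ) : a u ≠ 0 := fun h => one_ne_zero (congrFun h 0)
  have hab : HasEssentialParameters Set.univ a b := by
    refine hasEssentialParameters_of_leftInverse isOpen_univ
      (ha.differentiable (by simp)).differentiableOn
      (hb.differentiable (by simp)).differentiableOn (.proj 0) (fun _ _ => rfl) (fun _ _ => rfl)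
      (hr.differentiable (by simp)) fun u _ => ?_
    ext i
    fin_cases i <;> rfl
  refine ⟨Set.univ, a, b, Set.univ_nonempty,
    ⟨isOpen_univ, ha.contDiffOn, hb.contDiffOn, fun u _ => ha₀ u⟩, hab,
    fun u _ => ⟨⟨_, _, ha₀ u, rfl⟩, ?_⟩⟩
  rintro _ ⟨t, rfl⟩
  simp [reliabilityHypersurface_eq_graphSet, graphSet, reliability_eq, a, b, Fin.init]

theorem theorem4p5 :
    DependsOnAtLeast (linesIn reliabilityHypersurface) 5 ∧
      DependsOnAtMost (linesIn reliabilityHypersurface) 6 :=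
  ⟨dependsOnAtLeast_five, dependsOnAtMost_six⟩
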